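/- A two-fold marked link $(L,\omega)$ is a link $L\subset S^3$ (up to isotopy) with a function $\omega$ from its components to $\mathbb Z/2$ whose values sum to $0$; if the values sum to $1$, $(L,\omega)$ is called an odd-marked link. A two-fold marked diagram $(D,\check\omega)$ is a planar link diagram $D$ with a function $\check\omega$ from its arcs (the edges of the underlying $4$-valent graph) to $\mathbb Z/2$, drawn as dots on the arcs and counted mod $2$, with an even total number of dots; it represents $(L,\omega)$ when $D$ is a diagram of $L$ and $\omega(K)$ is the sum of $\check\omega$ over the arcs of $K$, for each component $K$. When a crossing of $D$ is replaced by one of its two smoothings, or by a tangle, the dots outside stay in place and no dots are put inside; this is the induced marking data. The set $\mathcal Q_2$ of two-fold quasi-alternating (TQA) two-fold marked links is the smallest set of two-fold marked links such that (1) the unknot with trivial marking is in $\mathcal Q_2$; (2) every two-fold marked link that splits into two odd-marked links is in $\mathcal Q_2$; (3) if $(L,\omega)$ has a diagram $(D,\check\omega)$ with a crossing $c$ whose $0$- and $1$-smoothings, with the induced marking data, represent two-fold marked links $(L_0,\omega_0)$ and $(L_1,\omega_1)$ in $\mathcal Q_2$, and $\det(L)=\det(L_0)+\det(L_1)$, then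 $(L,\omega)$ is in $\mathcal Q_2$. A crossing $c$ as in (3) is called a TQA crossing of $(D,\check\omega)$. The sign of a crossing, drawn as a four-ended tangle, is the sign of the slope of its overstrand. A rational tangle diagram extends a crossing $c$ if it is obtained from $c$ by successively adding finitely many (possibly no) crossings of the same sign as $c$, each of them on the right, left, top or bottom of the tangle built so far (so it is an alternating rational tangle). Proposition. Let $(D,\check\omega)$ be a two-fold marked diagram with a TQA crossing $c$. Let $D'$ be obtained from $D$ by replacing $c$ with an alternating rational tangle that extends $c$, and let $\check\omega'$ be the induced marking data. Then the two-fold marked link represented by $(D',\check\omega')$ is in $\mathcal Q_2$. -/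

import Mathlib

/-! ### Link diagrams with dots

A link diagram is drawn in the plane in general position with respect to the height function and
is read from the bottom to the top.  It is then a sequence of elementary slices: a minimum, a
maximum, a crossing of two neighbouring strands, or a dot on one strand, each with a number of
vertical strands to its left and to its right.  Every planar diagram has this form after a planar
isotopy, and every such sequence is a planar diagram. -/

namespace DottedLink

/-- The elementary pieces.  `cross true` is the crossing whose overstrand has positive slope
(it runs from the lower left to the upper right); `cross false` is the crossing whose overstrand
has negative slope. -/
inductive Piece where
  | cup : Piece
  | cap : Piece
  | cross (positive : Bool) : Piece
  | dot : Piece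
  deriving DecidableEq

/-- Number of strands that enter a piece from below. -/
def Piece.ins : Piece → ℕ
  | .cup => 0
  | .cap => 2
  | .cross _ => 2
  | .dot => 1

/-- Number of strands that leave a piece at the top. -/
def Piece.outs : Piece → ℕ
  | .cup => 2
  | .cap => 0
  | .cross _ => 2
  | .dot => 1

/-- An elementary slice: a piece with `pos` vertical strands to its left. -/
structure Slice where
  piece : Piece
  pos : ℕ
  deriving DecidableEq

/-- A sequence of slices, listed from the bottom to the top. -/
abbrev Word := List Slice

abbrev cup (i : ℕ) : Slice := ⟨.cup, i⟩
abbrev cap (i : ℕ) : Slice := ⟨.cap, i⟩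
abbrev cross (ε : Bool) (i : ℕ) : Slice := ⟨.cross ε, i⟩
abbrev dot (i : ℕ) : Slice := ⟨.dot, i⟩

/-- `IsTangle w m n`: the word `w` is a tangle diagram with `m` lower and `n` upper ends. -/
def IsTangle : Word → ℕ → ℕ → Prop
  | [], m, n => m = n
  | s :: w, m, n =>
      s.pos + s.piece.ins ≤ m ∧ IsTangle w (m - s.piece.ins + s.piece.outs) n

/-- The number of dots in a word. -/
def dots (w : Word) : ℕ := w.countP fun s => s.piece = .dot

theorem isTangle_append (u v : Word) (m n : ℕ) :
    IsTangle (u ++ v) m n ↔ ∃ k, IsTangle u m k ∧ IsTangle v k n := by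
  induction u generalizing m with
  | nil => simp [IsTangle]
  | cons s u ih => simp [IsTangle, ih, and_assoc]

theorem dots_append (u v : Word) : dots (u ++ v) = dots u + dots v := by
  simp [dots]

/-- A two-fold marked diagram: a link diagram with an even number of dots on its arcs.  The marking
data of an arc, and of a component, is its number of dots modulo 2. -/
structure MarkedDiagram where
  word : Word
  closed : IsTangle word 0 0
  even : Even (dots word)

/-! ### Two-fold marked links -/

/-- The local moves: planar isotopies, Reidemeister moves, sliding a dot along its component, and
cancelling two dots on a strand.  The symmetric closure is taken below. -/
inductive LocalMove : Word → Word → Prop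
  /-- Two pieces that are side by side may change their heights. -/
  | exchange (p q : Piece) (i k : ℕ) :
      LocalMove [⟨p, i⟩, ⟨q, i + p.outs + k⟩] [⟨q, i + p.ins + k⟩, ⟨p, i⟩]
  /-- A maximum and a minimum cancel. -/
  | zigzag_left (i : ℕ) : LocalMove [cup i, cap (i + 1)] []
  | zigzag_right (i : ℕ) : LocalMove [cup (i + 1), cap i] []
  /-- A strand slides over or under a maximum. -/
  | slide_cap (ε : Bool) (i : ℕ) :
      LocalMove [cross ε i, cap (i + 1)] [cross (!ε) (i + 1), cap i]
  /-- A strand slides over or under a minimum. -/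
  | slide_cup (ε : Bool) (i : ℕ) :
      LocalMove [cup (i + 1), cross ε i] [cup i, cross (!ε) (i + 1)]
  /-- First Reidemeister move. -/
  | reidemeister_one_cup (ε : Bool) (i : ℕ) : LocalMove [cup i, cross ε i] [cup i]
  | reidemeister_one_cap (ε : Bool) (i : ℕ) : LocalMove [cross ε i, cap i] [cap i]
  /-- Second Reidemeister move. -/
  | reidemeister_two (ε : Bool) (i : ℕ) : LocalMove [cross ε i, cross (!ε) i] []
  /-- Third Reidemeister move. -/
  | reidemeister_three (ε : Bool) (i : ℕ) :
      LocalMove [cross ε i, cross ε (i + 1), cross ε i]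
        [cross ε (i + 1), cross ε i, cross ε (i + 1)]
  /-- A dot slides over an extremum. -/
  | dot_cup (i : ℕ) : LocalMove [cup i, dot i] [cup i, dot (i + 1)]
  | dot_cap (i : ℕ) : LocalMove [dot i, cap i] [dot (i + 1), cap i]
  /-- A dot slides along its strand through a crossing. -/
  | dot_cross_left (ε : Bool) (i : ℕ) :
      LocalMove [dot i, cross ε i] [cross ε i, dot (i + 1)]
  | dot_cross_right (ε : Bool) (i : ℕ) :
      LocalMove [dot (i + 1), cross ε i] [cross ε i, dot i]
  /-- Two dots on the same strand cancel. -/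
  | dot_dot (i : ℕ) : LocalMove [dot i, dot i] []

/-- Two marked diagrams differ by one local move. -/
def Move (D E : MarkedDiagram) : Prop :=
  ∃ a b u v : Word, LocalMove u v ∧ D.word = a ++ u ++ b ∧ E.word = a ++ v ++ b

/-- Two-fold marked links: marked diagrams modulo the equivalence relation that the moves
generate. -/
def MarkedLink : Type := Quot Move

/-- The two-fold marked link that a marked diagram represents. -/
def MarkedDiagram.link (D : MarkedDiagram) : MarkedLink := Quot.mk Move D

/-- The round diagram of the unknot, without dots. -/
def unknot : MarkedDiagram where
  word := [cup 0, cap 0]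
  closed := by simp [IsTangle, Piece.ins, Piece.outs]
  even := by simp [dots]

/-- The diagram is a disjoint union of two link diagrams, one above a horizontal line and one below
it, each with an odd number of dots. -/
def MarkedDiagram.IsOddSplit (D : MarkedDiagram) : Prop :=
  ∃ u v : Word, D.word = u ++ v ∧ IsTangle u 0 0 ∧ IsTangle v 0 0 ∧ Odd (dots u) ∧ Odd (dots v)

/-! ### Rational tangles -/

/-- The side of a four-ended tangle to which a crossing is added. -/
inductive Side where
  | right : Side
  | left : Side
  | top : Side
  | bottom : Side

/-- Rational tangle diagrams (in twist form): start with two horizontal arcs (`zero`), two vertical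
arcs (`infty`) or a crossing, and repeatedly add a crossing between two neighbouring ends.  Here
`twist ε σ T` adds to `T` the crossing of sign `ε` on the side `σ`; consecutive crossings on the
same side form a row of twists. -/
inductive RationalTangle where
  | zero : RationalTangle
  | infty : RationalTangle
  | crossing (ε : Bool) : RationalTangle
  | twist (ε : Bool) (σ : Side) (T : RationalTangle) : RationalTangle

/-- The diagram of a rational tangle, with `i` vertical strands to its left. -/
def RationalTangle.word : RationalTangle → ℕ → Word
  | .zero, i => [cap i, cup i]
  | .infty, _ => []
  | .crossing ε, i => [cross ε i]
  | .twist ε .right T, i => [cup (i + 1)] ++ T.word i ++ [cross ε (i + 2), cap (i + 1)]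
  | .twist ε .left T, i => [cup (i + 1), cross ε i] ++ T.word (i + 2) ++ [cap (i + 1)]
  | .twist ε .top T, i => T.word i ++ [cross ε i]
  | .twist ε .bottom T, i => [cross ε i] ++ T.word i

/-- The rational tangle `T` extends a crossing of sign `ε`: it is obtained from that crossing by
adding crossings of the same sign only.  Such a tangle is alternating. -/
def RationalTangle.Extends (ε : Bool) : RationalTangle → Prop
  | .zero => False
  | .infty => False
  | .crossing ε' => ε' = ε
  | .twist ε' _ T => ε' = ε ∧ T.Extends ε

theorem RationalTangle.isTangle_word (T : RationalTangle) (i m : ℕ) (h : i + 2 ≤ m) :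
    IsTangle (T.word i) m m := by
  induction T generalizing i m with
  | zero =>
    simp only [word, IsTangle, Piece.ins, Piece.outs]
    omega
  | infty => simp [word, IsTangle]
  | crossing ε =>
    simp only [word, IsTangle, Piece.ins, Piece.outs]
    omega
  | twist ε σ T ih =>
    cases σ
    · rw [word, isTangle_append]
      refine ⟨m + 2, (isTangle_append _ _ _ _).2 ⟨m + 2, ?_, ih i (m + 2) (by omega)⟩, ?_⟩ <;>
      · simp only [IsTangle, Piece.ins, Piece.outs]
        omega
    · rw [word, isTangle_append]
      refine ⟨m + 2, (isTangle_append _ _ _ _).2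
        ⟨m + 2, ?_, ih (i + 2) (m + 2) (by omega)⟩, ?_⟩ <;>
      · simp only [IsTangle, Piece.ins, Piece.outs]
        omega
    · rw [word, isTangle_append]
      refine ⟨m, ih i m h, ?_⟩
      simp only [IsTangle, Piece.ins, Piece.outs]
      omega
    · rw [word, isTangle_append]
      refine ⟨m, ?_, ih i m h⟩
      simp only [IsTangle, Piece.ins, Piece.outs]
      omega

theorem RationalTangle.dots_word (T : RationalTangle) (i : ℕ) : dots (T.word i) = 0 := by
  induction T generalizing i with
  | zero => simp [word, dots]
  | infty => simp [word, dots]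
  | crossing ε => simp [word, dots]
  | twist ε σ T ih => cases σ <;> rw [word] <;> simp only [dots_append, ih] <;> simp [dots]

/-! ### Replacing a crossing -/

/-- A crossing of a marked diagram, given by its position in the word. -/
structure MarkedDiagram.Crossing (D : MarkedDiagram) where
  below : Word
  sign : Bool
  pos : ℕ
  above : Word
  word_eq : D.word = below ++ [cross sign pos] ++ above

/-- Replace the crossing `c` by the rational tangle `T`.  All dots stay where they are, and there is
no dot inside `T`. -/
def MarkedDiagram.replace (D : MarkedDiagram) (c : D.Crossing) (T : RationalTangle) :
    MarkedDiagram where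
  word := c.below ++ T.word c.pos ++ c.above
  closed := by
    have h := D.closed
    rw [c.word_eq, isTangle_append] at h
    obtain ⟨k, h₁, h₂⟩ := h
    rw [isTangle_append] at h₁
    obtain ⟨l, h₁, h₃⟩ := h₁
    simp only [IsTangle, Piece.ins, Piece.outs] at h₃
    obtain ⟨h₃, h₄⟩ := h₃
    have hkl : l = k := by omega
    subst hkl
    rw [isTangle_append]
    refine ⟨l, (isTangle_append _ _ _ _).2 ⟨l, h₁, T.isTangle_word _ _ h₃⟩, h₂⟩
  even := by
    have h := D.even
    rw [c.word_eq] at h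
    simp only [dots_append] at h
    have hc : dots [cross c.sign c.pos] = 0 := by simp [dots]
    rw [hc] at h
    simpa only [dots_append, T.dots_word] using h

/-- The 0-smoothing of `c`, which joins the two regions that the overstrand sweeps when it is turned
counterclockwise. -/
def MarkedDiagram.smoothing₀ (D : MarkedDiagram) (c : D.Crossing) : MarkedDiagram :=
  D.replace c (if c.sign then .infty else .zero)

/-- The 1-smoothing of `c`. -/
def MarkedDiagram.smoothing₁ (D : MarkedDiagram) (c : D.Crossing) : MarkedDiagram :=
  D.replace c (if c.sign then .zero else .infty)

/-! ### The determinant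

The determinant of a link `L` is `|V_L(-1)|`, where `V_L` is the Jones polynomial.  The Jones
polynomial is the Kauffman bracket (with value 1 on the unknot), up to a power of `-A ^ 3`, under
`t = A ^ (-4)`. -/

/-- The part of a crossingless diagram below some height: the strands that meet this height carry
the label of the arc below to which they belong; `fresh` is the next unused label, and `loops` is
the number of circles that lie completely below. -/
structure LoopState where
  labels : List ℕ
  fresh : ℕ
  loops : ℕ

/-- A minimum starts a new arc. -/
def LoopState.cup (i : ℕ) (s : LoopState) : LoopState where
  labels := s.labels.take i ++ [s.fresh, s.fresh] ++ s.labels.drop i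
  fresh := s.fresh + 1
  loops := s.loops

/-- A maximum closes a circle if its two ends belong to the same arc, and otherwise joins two
arcs. -/
def LoopState.cap (i : ℕ) (s : LoopState) : LoopState :=
  let a := s.labels.getD i 0
  let b := s.labels.getD (i + 1) 0
  let rest := s.labels.take i ++ s.labels.drop (i + 2)
  if a = b then ⟨rest, s.fresh, s.loops + 1⟩
  else ⟨rest.map fun x => if x = b then a else x, s.fresh, s.loops⟩

/-- The state sum of the diagrams that begin with the crossingless part `s` and continue with the
given word: a crossing contributes `A` times its 0-smoothing plus `A⁻¹` times its 1-smoothing, and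
a crossingless diagram with `k` circles has the value `(-A ^ 2 - A ^ (-2)) ^ (k - 1)`. -/
def bracketFrom {K : Type*} [Field K] (A : K) : Word → LoopState → K
  | [], s => (-A ^ 2 - A⁻¹ ^ 2) ^ (s.loops - 1)
  | ⟨.cup, i⟩ :: w, s => bracketFrom A w (s.cup i)
  | ⟨.cap, i⟩ :: w, s => bracketFrom A w (s.cap i)
  | ⟨.dot, _⟩ :: w, s => bracketFrom A w s
  | ⟨.cross true, i⟩ :: w, s =>
      A * bracketFrom A w s + A⁻¹ * bracketFrom A w ((s.cap i).cup i)
  | ⟨.cross false, i⟩ :: w, s =>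
      A * bracketFrom A w ((s.cap i).cup i) + A⁻¹ * bracketFrom A w s

/-- The Kauffman bracket of the diagram, evaluated at `A`. -/
def MarkedDiagram.bracket {K : Type*} [Field K] (A : K) (D : MarkedDiagram) : K :=
  bracketFrom A D.word ⟨[], 0, 0⟩

/-- The determinant of the link that the diagram represents: the absolute value of the Jones
polynomial at `t = -1`, where `A = exp (π i / 4)`. -/
noncomputable def MarkedDiagram.det (D : MarkedDiagram) : ℝ :=
  ‖D.bracket (Complex.exp (Real.pi / 4 * Complex.I))‖

/-! ### Two-fold quasi-alternating links -/

/-- Two-fold quasi-alternating (TQA) two-fold marked links: the smallest set of two-fold marked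
links that is closed under the three rules. -/
inductive TQA : MarkedLink → Prop
  | unknot : TQA unknot.link
  | split (D : MarkedDiagram) (h : D.IsOddSplit) : TQA D.link
  | resolve (D : MarkedDiagram) (c : D.Crossing)
      (h₀ : TQA (D.smoothing₀ c).link) (h₁ : TQA (D.smoothing₁ c).link)
      (hdet : D.det = (D.smoothing₀ c).det + (D.smoothing₁ c).det) : TQA D.link

/-- `c` is a crossing of `D` as in the third rule for TQA links. -/
structure MarkedDiagram.Crossing.IsTQA {D : MarkedDiagram} (c : D.Crossing) : Prop where
  smoothing₀ : TQA (D.smoothing₀ c).link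
  smoothing₁ : TQA (D.smoothing₁ c).link
  det_eq : D.det = (D.smoothing₀ c).det + (D.smoothing₁ c).det

end DottedLink

namespace DottedLink

/-! ### Loop states -/

namespace LoopState

/-! Everything reduces to one added crossing: if `c` is TQA and a crossing of the same sign is added
on some side, then the original crossing is TQA in the new diagram (`IsTQA.inner`). Regrouping words
(`replace_inner`) shows that replacing this crossing by `T` in the new diagram gives the same
diagram as replacing `c` by `twist ε σ T`, so induction on the tangle, over all diagrams, finishes.

For one added crossing, smooth the original one. If the new crossing is on the right or left, the
vertical smoothing is a kink on a vertical strand, isotopic to the vertical smoothing of `c`, and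
the horizontal one straightens to `D`. On the top or bottom, the vertical smoothing is `D` itself
and the horizontal one is a kinked copy of the horizontal smoothing of `c`. All these links are TQA.

For the determinants, let `X` and `Y` be the brackets of the vertical and horizontal smoothings of
`c`, so that `D` has bracket `p * X + q * Y` with `p`, `q` of norm 1. At `A = exp (π i / 4)` a
circle has value 0, hence a kink contributes just one factor `p` or `q`. Up to a unit the new
bracket is `p * X + 2 * q * Y` or `2 * p * X + q * Y`. The hypothesis is equality in the triangle
inequality for `p * X` and `q * Y`; they lie on a common ray, so the new norms add too. The brackets
of the kinked diagrams are computed directly, so invariance of `det` under the moves is never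
needed. -/

theorem cup_append (P Q : List ℕ) (f l : ℕ) :
    (⟨P ++ Q, f, l⟩ : LoopState).cup P.length = ⟨P ++ f :: f :: Q, f + 1, l⟩ := by
  simp [cup]

/-- Splitting the list at the extremum removes `take`, `drop` and `getD`; later computations with
states use this form. The merged arc keeps the left label `x`. -/
theorem cap_append (P Q : List ℕ) (x y f l : ℕ) :
    (⟨P ++ x :: y :: Q, f, l⟩ : LoopState).cap P.length =
      if x = y then ⟨P ++ Q, f, l + 1⟩
      else ⟨(P ++ Q).map fun z => if z = y then x else z, f, l⟩ := by
  simp [cap, ← List.drop_drop]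

theorem exists_split {L : List ℕ} {i : ℕ} (h : i ≤ L.length) :
    ∃ P Q, L = P ++ Q ∧ P.length = i :=
  ⟨L.take i, L.drop i, by simp, by simpa using h⟩

theorem exists_split_one {L : List ℕ} {i : ℕ} (h : i + 1 ≤ L.length) :
    ∃ P x Q, L = P ++ x :: Q ∧ P.length = i := by
  obtain ⟨P, Q, rfl, rfl⟩ := exists_split (show i ≤ L.length by omega)
  cases Q with
  | nil => simp at h
  | cons x Q => exact ⟨P, x, Q, rfl, rfl⟩

theorem exists_split_two {L : List ℕ} {i : ℕ} (h : i + 2 ≤ L.length) :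
    ∃ P x y Q, L = P ++ x :: y :: Q ∧ P.length = i := by
  obtain ⟨P, x, Q, rfl, rfl⟩ := exists_split_one (show i + 1 ≤ L.length by omega)
  cases Q with
  | nil => simp at h
  | cons y Q => exact ⟨P, x, y, Q, rfl, rfl⟩

theorem length_cup (s : LoopState) {i : ℕ} (h : i ≤ s.labels.length) :
    (s.cup i).labels.length = s.labels.length + 2 := by
  obtain ⟨L, f, l⟩ := s
  obtain ⟨P, Q, rfl, rfl⟩ := exists_split h
  rw [cup_append]
  simp
  omega

theorem length_cap (s : LoopState) {i : ℕ} (h : i + 2 ≤ s.labels.length) :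
    (s.cap i).labels.length = s.labels.length - 2 := by
  obtain ⟨L, f, l⟩ := s
  obtain ⟨P, x, y, Q, rfl, rfl⟩ := exists_split_two h
  rw [cap_append]
  split_ifs <;> simp <;> omega

theorem loops_le_loops_cap (s : LoopState) (i : ℕ) : s.loops ≤ (s.cap i).loops := by
  simp only [cap]
  split_ifs <;> simp

/-- The labels have been used already, and each of them marks an even number of strands. -/
structure WellFormed (s : LoopState) : Prop where
  lt_fresh : ∀ x ∈ s.labels, x < s.fresh
  even_count : ∀ x, Even (s.labels.count x)

theorem WellFormed.cup {s : LoopState} (hs : s.WellFormed) {i : ℕ} (h : i ≤ s.labels.length) :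
    (s.cup i).WellFormed := by
  obtain ⟨L, f, l⟩ := s
  obtain ⟨P, Q, rfl, rfl⟩ := exists_split h
  obtain ⟨h₁, h₂⟩ := hs
  rw [cup_append]
  refine ⟨fun x hx => ?_, fun x => ?_⟩
  · simp only [List.mem_append, List.mem_cons] at hx h₁ ⊢
    rcases hx with hx | rfl | rfl | hx
    · exact Nat.lt_succ_of_lt (h₁ x (.inl hx))
    · exact Nat.lt_succ_self _
    · exact Nat.lt_succ_self _
    · exact Nat.lt_succ_of_lt (h₁ x (.inr hx))
  · have := h₂ x
    simp only [List.count_append, List.count_cons] at this ⊢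
    split_ifs <;> grind

theorem count_map_merge (R : List ℕ) {x y : ℕ} (hxy : x ≠ y) (z : ℕ) :
    (R.map fun t => if t = y then x else t).count z =
      if z = y then 0 else if z = x then R.count x + R.count y else R.count z := by
  induction R with
  | nil => simp
  | cons t R ih =>
    simp only [List.map_cons, List.count_cons, ih, beq_iff_eq]
    grind

/-- A maximum removes two strands of one class, or merges two even classes and removes a strand from
each; parity survives either way. -/
theorem WellFormed.cap {s : LoopState} (hs : s.WellFormed) {i : ℕ}
    (h : i + 2 ≤ s.labels.length) : (s.cap i).WellFormed := by
  obtain ⟨L, f, l⟩ := s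
  obtain ⟨P, x, y, Q, rfl, rfl⟩ := exists_split_two h
  obtain ⟨h₁, h₂⟩ := hs
  rw [cap_append]
  simp only [List.mem_append, List.mem_cons] at h₁
  simp only [List.count_append, List.count_cons, beq_iff_eq] at h₂
  split_ifs with hxy
  · subst hxy
    refine ⟨fun z hz => ?_, fun z => ?_⟩
    · simp only [List.mem_append] at hz
      exact h₁ z (by tauto)
    · have := h₂ z
      simp only [List.count_append]
      split_ifs at this <;> grind
  · refine ⟨fun z hz => ?_, fun z => ?_⟩
    · simp only [List.mem_map, List.mem_append] at hz
      obtain ⟨t, ht, rfl⟩ := hz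
      split_ifs
      · exact h₁ x (by tauto)
      · exact h₁ t (by tauto)
    · simp only [count_map_merge _ hxy, List.count_append]
      have hx := h₂ x
      have hy := h₂ y
      have hz := h₂ z
      grind

/-- The two states differ by a renaming of the labels. -/
def Renaming (s t : LoopState) : Prop :=
  ∃ g : ℕ → ℕ, (∀ x ∈ s.labels, ∀ y ∈ s.labels, g x = g y → x = y) ∧
    t.labels = s.labels.map g ∧ t.loops = s.loops

theorem Renaming.length_eq {s t : LoopState} (h : s.Renaming t) :
    t.labels.length = s.labels.length := by
  obtain ⟨g, -, h, -⟩ := h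
  simp [h]

theorem Renaming.cup {s t : LoopState} (h : s.Renaming t) (hs : s.WellFormed)
    (ht : t.WellFormed) {i : ℕ} (hi : i ≤ s.labels.length) : (s.cup i).Renaming (t.cup i) := by
  obtain ⟨L, f, l⟩ := s
  obtain ⟨L', f', l'⟩ := t
  obtain ⟨P, Q, rfl, rfl⟩ := exists_split hi
  obtain ⟨g, hg, hL, rfl⟩ := h
  dsimp only at hL
  subst hL
  have h₁ := hs.lt_fresh
  have h₂ := ht.lt_fresh
  dsimp only at hg h₁ h₂
  have hne : ∀ x ∈ P ++ Q, x ≠ f := fun x hx => (h₁ x hx).ne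
  have hne' : ∀ x ∈ P ++ Q, g x ≠ f' := fun x hx => (h₂ _ (List.mem_map_of_mem hx)).ne
  rw [cup_append, List.map_append, ← List.length_map (f := g) (as := P), cup_append]
  -- The new label of `s` must go to the new label of `t`. Well-formedness of both states keeps the
  -- map injective and unchanged on old labels.
  refine ⟨Function.update g f f', ?_, ?_, rfl⟩
  · intro x hx y hy
    simp only [List.mem_append, List.mem_cons] at hx hy hg hne hne'
    simp only [Function.update_apply]
    grind
  · have hP : P.map (Function.update g f f') = P.map g :=
      List.map_congr_left fun x hx =>
        Function.update_of_ne (hne x (List.mem_append_left _ hx)) _ _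
    have hQ : Q.map (Function.update g f f') = Q.map g :=
      List.map_congr_left fun x hx =>
        Function.update_of_ne (hne x (List.mem_append_right _ hx)) _ _
    simp [hP, hQ]

/-- Injectivity on the labels in use makes both states take the same branch, closing a circle or
merging, and makes merging commute with the renaming. -/
theorem Renaming.cap {s t : LoopState} (h : s.Renaming t) {i : ℕ}
    (hi : i + 2 ≤ s.labels.length) : (s.cap i).Renaming (t.cap i) := by
  obtain ⟨L, f, l⟩ := s
  obtain ⟨L', f', l'⟩ := t
  obtain ⟨P, x, y, Q, rfl, rfl⟩ := exists_split_two hi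
  obtain ⟨g, hg, hL, rfl⟩ := h
  dsimp only at hL
  subst hL
  simp only [List.mem_append, List.mem_cons] at hg
  have hxy : g x = g y ↔ x = y := ⟨hg x (by tauto) y (by tauto), fun h => by rw [h]⟩
  rw [cap_append, List.map_append, List.map_cons, List.map_cons,
    ← List.length_map (f := g) (as := P), cap_append]
  simp only [hxy]
  split_ifs with hne
  · refine ⟨g, fun a ha b hb => ?_, by simp, rfl⟩
    simp only [List.mem_append] at ha hb
    exact hg a (by tauto) b (by tauto)
  · refine ⟨g, fun a ha b hb => ?_, ?_, rfl⟩
    · simp only [List.mem_map, List.mem_append] at ha hb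
      obtain ⟨a, ha, rfl⟩ := ha
      obtain ⟨b, hb, rfl⟩ := hb
      refine hg _ ?_ _ ?_
      · split_ifs <;> tauto
      · split_ifs <;> tauto
    · simp only [← List.map_append, List.map_map]
      refine List.map_congr_left fun a ha => ?_
      simp only [List.mem_append] at ha
      have : g a = g y ↔ a = y := ⟨hg a (by tauto) y (by tauto), fun h => by rw [h]⟩
      simp only [Function.comp_apply, this]
      split_ifs <;> rfl

theorem renaming_cup_cap_right {s : LoopState} (hs : s.WellFormed) {i : ℕ}
    (hi : i + 1 ≤ s.labels.length) : s.Renaming ((s.cup (i + 1)).cap i) := by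
  obtain ⟨L, f, l⟩ := s
  obtain ⟨P, x, Q, rfl, rfl⟩ := exists_split_one hi
  have h := hs.lt_fresh
  have hx : x ≠ f := (h x (by simp)).ne
  have h₁ := cup_append (P ++ [x]) Q f l
  simp only [List.append_assoc, List.singleton_append, List.length_append,
    List.length_singleton] at h₁
  rw [h₁, cap_append, if_neg hx]
  -- The fresh label is absorbed into `x`, so only the counter `fresh` changes.
  refine ⟨id, fun _ _ _ _ h => h, ?_, rfl⟩
  have hne : ∀ z ∈ P ++ x :: Q, z ≠ f := fun z hz => (h z hz).ne
  have hP : (P.map fun z => if z = f then x else z) = P := by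
    conv_rhs => rw [← List.map_id P]
    exact List.map_congr_left fun z hz => if_neg (hne z (by simp [hz]))
  have hQ : (Q.map fun z => if z = f then x else z) = Q := by
    conv_rhs => rw [← List.map_id Q]
    exact List.map_congr_left fun z hz => if_neg (hne z (by simp [hz]))
  simp [hP, hQ]

theorem renaming_cup_cap_left {s : LoopState} (hs : s.WellFormed) {i : ℕ}
    (hi : i + 1 ≤ s.labels.length) : s.Renaming ((s.cup i).cap (i + 1)) := by
  obtain ⟨L, f, l⟩ := s
  obtain ⟨P, x, Q, rfl, rfl⟩ := exists_split_one hi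
  have h := hs.lt_fresh
  dsimp only at h
  have hx : f ≠ x := (h x (by simp)).ne'
  have h₁ := cap_append (P ++ [f]) Q f x (f + 1) l
  simp only [List.append_assoc, List.singleton_append, List.length_append,
    List.length_singleton] at h₁
  rw [cup_append, h₁, if_neg hx]
  -- Here the fresh label is the left one and survives, so the class of `x` is renamed to `f`.
  refine ⟨fun z => if z = x then f else z, fun a ha b hb => ?_, ?_, rfl⟩
  · have := h a ha
    have := h b hb
    grind
  · simp

theorem cup_cap_eq_cap_cup {s : LoopState} (hs : s.WellFormed) {i : ℕ}
    (hi : i + 2 ≤ s.labels.length) : (s.cup i).cap (i + 2) = (s.cap i).cup i := by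
  obtain ⟨L, f, l⟩ := s
  obtain ⟨P, x, y, Q, rfl, rfl⟩ := exists_split_two hi
  have hy : f ≠ y := (hs.lt_fresh y (by simp)).ne'
  have h₁ := cap_append (P ++ [f, f]) Q x y (f + 1) l
  simp only [List.append_assoc, List.cons_append, List.nil_append, List.length_append,
    List.length_cons, List.length_nil, Nat.zero_add] at h₁
  rw [cup_append, h₁, cap_append]
  split_ifs
  · rw [cup_append]
  · have h₂ := cup_append (P.map fun z => if z = y then x else z)
      (Q.map fun z => if z = y then x else z) f l
    rw [List.length_map] at h₂
    simp [h₂, hy]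

theorem cup_cap_self {s : LoopState} {i : ℕ} (hi : i ≤ s.labels.length) :
    (s.cup i).cap i = ⟨s.labels, s.fresh + 1, s.loops + 1⟩ := by
  obtain ⟨L, f, l⟩ := s
  obtain ⟨P, Q, rfl, rfl⟩ := exists_split hi
  rw [cup_append, cap_append, if_pos rfl]

end LoopState

/-! ### The state sum -/

section StateSum

variable {K : Type*} [Field K]

/-- The coefficient of the vertical smoothing of a crossing. -/
def inftyCoeff (A : K) (ε : Bool) : K := if ε then A else A⁻¹

/-- The coefficient of the horizontal smoothing of a crossing. -/
def zeroCoeff (A : K) (ε : Bool) : K := if ε then A⁻¹ else A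

theorem bracketFrom_cup (A : K) (i : ℕ) (w : Word) (s : LoopState) :
    bracketFrom A (cup i :: w) s = bracketFrom A w (s.cup i) := by
  simp [bracketFrom]

theorem bracketFrom_cap (A : K) (i : ℕ) (w : Word) (s : LoopState) :
    bracketFrom A (cap i :: w) s = bracketFrom A w (s.cap i) := by
  simp [bracketFrom]

theorem bracketFrom_dot (A : K) (i : ℕ) (w : Word) (s : LoopState) :
    bracketFrom A (dot i :: w) s = bracketFrom A w s := by
  simp [bracketFrom]

theorem bracketFrom_cross (A : K) (ε : Bool) (i : ℕ) (w : Word) (s : LoopState) :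
    bracketFrom A (cross ε i :: w) s =
      inftyCoeff A ε * bracketFrom A w s + zeroCoeff A ε * bracketFrom A w ((s.cap i).cup i) := by
  cases ε <;> simp [bracketFrom, inftyCoeff, zeroCoeff, add_comm]

theorem LoopState.length_cap_cup (s : LoopState) {i : ℕ} (h : i + 2 ≤ s.labels.length) :
    ((s.cap i).cup i).labels.length = s.labels.length := by
  rw [length_cup _ (by rw [length_cap _ h]; omega), length_cap _ h]
  omega

theorem LoopState.WellFormed.cap_cup {s : LoopState} (hs : s.WellFormed) {i : ℕ}
    (h : i + 2 ≤ s.labels.length) : ((s.cap i).cup i).WellFormed :=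
  (hs.cap h).cup (by rw [length_cap _ h]; omega)

theorem LoopState.Renaming.cap_cup {s t : LoopState} (h : s.Renaming t) (hs : s.WellFormed)
    (ht : t.WellFormed) {i : ℕ} (hi : i + 2 ≤ s.labels.length) :
    ((s.cap i).cup i).Renaming ((t.cap i).cup i) :=
  (h.cap hi).cup (hs.cap hi) (ht.cap (by rw [h.length_eq]; exact hi))
    (by rw [length_cap _ hi]; omega)

/-- The state sum sees only which strands share an arc and how many circles are closed. This turns
zigzag cancellation, which holds only up to relabelling, into an equality of state sums. -/
theorem bracketFrom_eq_of_renaming (A : K) (w : Word) {s t : LoopState} (h : s.Renaming t)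
    (hs : s.WellFormed) (ht : t.WellFormed) (hw : IsTangle w s.labels.length 0) :
    bracketFrom A w s = bracketFrom A w t := by
  induction w generalizing s t with
  | nil =>
    obtain ⟨-, -, -, h⟩ := h
    simp [bracketFrom, h]
  | cons p w ih =>
    obtain ⟨p, i⟩ := p
    obtain ⟨hi, hw⟩ := hw
    have hl := h.length_eq
    cases p with
    | cup =>
      rw [bracketFrom_cup, bracketFrom_cup]
      simp only [Piece.ins, Piece.outs, add_zero, Nat.sub_zero] at hi hw
      exact ih (h.cup hs ht hi) (hs.cup hi) (ht.cup (by omega)) (by rwa [s.length_cup hi])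
    | cap =>
      rw [bracketFrom_cap, bracketFrom_cap]
      simp only [Piece.ins, Piece.outs, add_zero] at hi hw
      exact ih (h.cap hi) (hs.cap hi) (ht.cap (by omega)) (by rwa [s.length_cap hi])
    | dot =>
      rw [bracketFrom_dot, bracketFrom_dot]
      simp only [Piece.ins, Piece.outs] at hi hw
      exact ih h hs ht (by rwa [Nat.sub_add_cancel (by omega)] at hw)
    | cross ε =>
      simp only [Piece.ins, Piece.outs] at hi hw
      rw [Nat.sub_add_cancel (by omega)] at hw
      rw [bracketFrom_cross, bracketFrom_cross, ih h hs ht hw,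
        ih (h.cap_cup hs ht hi) (hs.cap_cup hi) (ht.cap_cup (by omega))
          (by rwa [s.length_cap_cup hi])]

/-- If a circle has the value zero, then so does a diagram with a circle and something else. -/
theorem bracketFrom_eq_zero {A : K} (hA : A ^ 2 + A⁻¹ ^ 2 = 0) (w : Word) {s : LoopState}
    (hs : s.WellFormed) (hw : IsTangle w s.labels.length 0) (hl : 1 ≤ s.loops)
    (h : s.labels ≠ [] ∨ 2 ≤ s.loops) : bracketFrom A w s = 0 := by
  induction w generalizing s with
  | nil =>
    have h₀ : s.labels = [] := List.length_eq_zero_iff.1 hw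
    have h₂ : 2 ≤ s.loops := h.resolve_left (not_not_intro h₀)
    have hδ : -A ^ 2 - A⁻¹ ^ 2 = 0 := by linear_combination -hA
    -- At least two circles are closed, so the truncated exponent `loops - 1` is positive.
    rw [bracketFrom, hδ, zero_pow (by omega)]
  | cons p w ih =>
    obtain ⟨p, i⟩ := p
    obtain ⟨hi, hw⟩ := hw
    cases p with
    | cup =>
      rw [bracketFrom_cup]
      simp only [Piece.ins, Piece.outs, add_zero, Nat.sub_zero] at hi hw
      refine ih (hs.cup hi) (by rwa [s.length_cup hi]) hl (.inl ?_)
      rw [← List.length_pos_iff, s.length_cup hi]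
      omega
    | cap =>
      rw [bracketFrom_cap]
      simp only [Piece.ins, Piece.outs, add_zero] at hi hw
      refine ih (hs.cap hi) (by rwa [s.length_cap hi]) (hl.trans (s.loops_le_loops_cap i)) ?_
      rcases h with h | h
      · obtain ⟨L, f, l⟩ := s
        obtain ⟨P, x, y, Q, rfl, rfl⟩ := LoopState.exists_split_two hi
        rw [LoopState.cap_append]
        split_ifs with hxy
        · exact .inr (Nat.succ_le_succ hl)
        · left
          intro h₀
          simp only [List.map_eq_nil_iff, List.append_eq_nil_iff] at h₀
          obtain ⟨rfl, rfl⟩ := h₀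
          -- If no strand remains, the labels were just `x` and `y`; being distinct, each would
          -- occur once, against parity. So the last maximum always closes a circle.
          have := hs.even_count x
          simp [Ne.symm hxy] at this
      · exact .inr (h.trans (s.loops_le_loops_cap i))
    | dot =>
      rw [bracketFrom_dot]
      simp only [Piece.ins, Piece.outs] at hi hw
      exact ih hs (by rwa [Nat.sub_add_cancel (by omega)] at hw) hl h
    | cross ε =>
      simp only [Piece.ins, Piece.outs] at hi hw
      rw [Nat.sub_add_cancel (by omega)] at hw
      have hne : ((s.cap i).cup i).labels ≠ [] := by
        rw [← List.length_pos_iff, s.length_cap_cup hi]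
        omega
      rw [bracketFrom_cross, ih hs hw hl h,
        ih (hs.cap_cup hi) (by rwa [s.length_cap_cup hi])
          (hl.trans (s.loops_le_loops_cap i)) (.inl hne)]
      simp

/-- A linear relation between state sums holds in every context. -/
theorem bracketFrom_append_eq (A α β : K) (a u v w : Word) (m : ℕ)
    (h : ∀ s : LoopState, s.WellFormed → s.labels.length = m →
      bracketFrom A u s = α * bracketFrom A v s + β * bracketFrom A w s)
    {s : LoopState} (hs : s.WellFormed) (ha : IsTangle a s.labels.length m) :
    bracketFrom A (a ++ u) s = α * bracketFrom A (a ++ v) s + β * bracketFrom A (a ++ w) s := by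
  induction a generalizing s with
  | nil => exact h s hs ha
  | cons p a ih =>
    obtain ⟨p, i⟩ := p
    obtain ⟨hi, ha⟩ := ha
    simp only [List.cons_append]
    cases p with
    | cup =>
      simp only [Piece.ins, Piece.outs, add_zero, Nat.sub_zero] at hi ha
      simp only [bracketFrom_cup]
      exact ih (hs.cup hi) (by rwa [s.length_cup hi])
    | cap =>
      simp only [Piece.ins, Piece.outs, add_zero] at hi ha
      simp only [bracketFrom_cap]
      exact ih (hs.cap hi) (by rwa [s.length_cap hi])
    | dot =>
      simp only [Piece.ins, Piece.outs] at hi ha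
      simp only [bracketFrom_dot]
      exact ih hs (by rwa [Nat.sub_add_cancel (by omega)] at ha)
    | cross ε =>
      simp only [Piece.ins, Piece.outs] at hi ha
      rw [Nat.sub_add_cancel (by omega)] at ha
      simp only [bracketFrom_cross]
      rw [ih hs ha, ih (hs.cap_cup hi) (by rwa [s.length_cap_cup hi])]
      ring

/-! ### Zigzags and small circles in the state sum -/

section LocalRelations

variable (A : K) {b : Word} {s : LoopState} {i : ℕ}

theorem bracketFrom_cup_cap_right (hs : s.WellFormed) (hb : IsTangle b s.labels.length 0)
    (hi : i + 1 ≤ s.labels.length) :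
    bracketFrom A b ((s.cup (i + 1)).cap i) = bracketFrom A b s :=
  (bracketFrom_eq_of_renaming A b (LoopState.renaming_cup_cap_right hs hi) hs
    ((hs.cup hi).cap (by rw [s.length_cup hi]; omega)) hb).symm

theorem bracketFrom_cup_cap_left (hs : s.WellFormed) (hb : IsTangle b s.labels.length 0)
    (hi : i + 1 ≤ s.labels.length) :
    bracketFrom A b ((s.cup i).cap (i + 1)) = bracketFrom A b s :=
  have hi' : i ≤ s.labels.length := by omega
  (bracketFrom_eq_of_renaming A b (LoopState.renaming_cup_cap_left hs hi) hs
    ((hs.cup hi').cap (by rw [s.length_cup hi']; omega)) hb).symm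

variable {A}

/-- A lone circle has value 1, not 0; the vanishing comes from a further circle, which `s.labels ≠
[]` guarantees. -/
theorem bracketFrom_cup_cap_self (hA : A ^ 2 + A⁻¹ ^ 2 = 0) (hs : s.WellFormed)
    (hb : IsTangle b s.labels.length 0) (hi : i ≤ s.labels.length) (h : s.labels ≠ []) :
    bracketFrom A b ((s.cup i).cap i) = 0 := by
  rw [LoopState.cup_cap_self hi]
  exact bracketFrom_eq_zero hA b
    ⟨fun x hx => Nat.lt_succ_of_lt (hs.lt_fresh x hx), hs.even_count⟩ hb (by simp) (.inl h)

theorem bracketFrom_cap_cup_cap_cup (hA : A ^ 2 + A⁻¹ ^ 2 = 0) (hs : s.WellFormed)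
    (hb : IsTangle b s.labels.length 0) (hi : i + 2 ≤ s.labels.length) :
    bracketFrom A b ((((s.cap i).cup i).cap i).cup i) = 0 := by
  have hl := s.length_cap_cup hi
  have hl' := ((s.cap i).cup i).length_cap_cup (i := i) (by omega)
  refine bracketFrom_eq_zero hA b ((hs.cap_cup hi).cap_cup (by omega)) (by rwa [hl', hl]) ?_
    (.inl ?_)
  · rw [LoopState.cup_cap_self (by rw [s.length_cap hi]; omega)]
    exact Nat.le_add_left _ _
  · rw [← List.length_pos_iff, hl', hl]
    omega

end LocalRelations

end StateSum

/-! ### Adding a crossing to a tangle -/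

/-- The part of the diagram of `twist ε σ T` below `T`. -/
def Side.below (ε : Bool) : Side → ℕ → Word
  | .right, i => [cup (i + 1)]
  | .left, i => [cup (i + 1), cross ε i]
  | .top, _ => []
  | .bottom, i => [cross ε i]

/-- The part of the diagram of `twist ε σ T` above `T`. -/
def Side.above (ε : Bool) : Side → ℕ → Word
  | .right, i => [cross ε (i + 2), cap (i + 1)]
  | .left, i => [cap (i + 1)]
  | .top, i => [cross ε i]
  | .bottom, _ => []

/-- The position of `T` in the diagram of `twist ε σ T`. -/
def Side.pos : Side → ℕ → ℕ
  | .left, i => i + 2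
  | _, i => i

theorem RationalTangle.word_twist (ε : Bool) (σ : Side) (T : RationalTangle) (i : ℕ) :
    (RationalTangle.twist ε σ T).word i = σ.below ε i ++ T.word (σ.pos i) ++ σ.above ε i := by
  cases σ <;> simp [word, Side.below, Side.above, Side.pos]

theorem MarkedDiagram.eq_of_word_eq {D E : MarkedDiagram} (h : D.word = E.word) : D = E := by
  cases D
  cases E
  cases h
  rfl

namespace MarkedDiagram.Crossing

variable {D : MarkedDiagram} (c : D.Crossing)

theorem replace_crossing : D.replace c (.crossing c.sign) = D :=
  eq_of_word_eq c.word_eq.symm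

theorem exists_isTangle :
    ∃ m, c.pos + 2 ≤ m ∧ IsTangle c.below 0 m ∧ IsTangle c.above m 0 := by
  have h := D.closed
  rw [c.word_eq, isTangle_append] at h
  obtain ⟨k, h₁, h₂⟩ := h
  rw [isTangle_append] at h₁
  obtain ⟨l, h₁, h₃, h₄⟩ := h₁
  simp only [IsTangle, Piece.ins, Piece.outs] at h₃ h₄
  rw [Nat.sub_add_cancel (by omega)] at h₄
  exact ⟨l, h₃, h₁, h₄ ▸ h₂⟩

/-- The original crossing, in the diagram in which another crossing was added to it. -/
def inner (ε : Bool) (σ : Side) : (D.replace c (.twist ε σ (.crossing c.sign))).Crossing where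
  below := c.below ++ σ.below ε c.pos
  sign := c.sign
  pos := σ.pos c.pos
  above := σ.above ε c.pos ++ c.above
  word_eq := by simp [replace, RationalTangle.word_twist, RationalTangle.word]

/-- A twist is a fixed context around its core, so this is associativity of concatenation. It lets
an induction peel off the outermost crossing. -/
theorem replace_inner (ε : Bool) (σ : Side) (T : RationalTangle) :
    (D.replace c (.twist ε σ (.crossing c.sign))).replace (c.inner ε σ) T =
      D.replace c (.twist ε σ T) :=
  eq_of_word_eq (by simp [replace, RationalTangle.word_twist, inner])

/-- The sign only decides which smoothing is called 0 and which 1, and the TQA condition is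
symmetric in them. Both signs can then be treated at once. -/
theorem isTQA_iff : c.IsTQA ↔ TQA (D.replace c .infty).link ∧ TQA (D.replace c .zero).link ∧
    D.det = (D.replace c .infty).det + (D.replace c .zero).det := by
  cases h : c.sign
  · refine ⟨fun ⟨h₀, h₁, h₂⟩ => ?_, fun ⟨h₀, h₁, h₂⟩ => ⟨?_, ?_, ?_⟩⟩ <;>
      simp_all [smoothing₀, smoothing₁, add_comm]
  · refine ⟨fun ⟨h₀, h₁, h₂⟩ => ?_, fun ⟨h₀, h₁, h₂⟩ => ⟨?_, ?_, ?_⟩⟩ <;>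
      simp_all [smoothing₀, smoothing₁]

theorem IsTQA.tqa {c : D.Crossing} (hc : c.IsTQA) : TQA D.link :=
  .resolve D c hc.smoothing₀ hc.smoothing₁ hc.det_eq

end MarkedDiagram.Crossing

/-! ### Isotopies of tangles -/

/-- The two words are tangle diagrams with the same ends, and exchanging them in a closed diagram
does not change the link. -/
structure Isotopic (m n : ℕ) (u v : Word) : Prop where
  left : IsTangle u m n
  right : IsTangle v m n
  even_dots : Even (dots u) ↔ Even (dots v)
  link_eq : ∀ (D E : MarkedDiagram) (a b : Word), IsTangle a 0 m → IsTangle b n 0 →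
    D.word = a ++ u ++ b → E.word = a ++ v ++ b → D.link = E.link

namespace Isotopic

variable {k l m n : ℕ} {u v w a b : Word}

theorem symm (h : Isotopic m n u v) : Isotopic m n v u :=
  ⟨h.right, h.left, h.even_dots.symm,
    fun D E a b ha hb hD hE => (h.link_eq E D a b ha hb hE hD).symm⟩

theorem trans (h : Isotopic m n u v) (h' : Isotopic m n v w) : Isotopic m n u w := by
  refine ⟨h.left, h'.right, h.even_dots.trans h'.even_dots, fun D E a b ha hb hD hE => ?_⟩
  -- The intermediate word must itself be a marked diagram; this is why `Isotopic` records the ends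
  -- and the parity of dots.
  have hc : IsTangle (a ++ v ++ b) 0 0 :=
    (isTangle_append _ _ _ _).2 ⟨n, (isTangle_append _ _ _ _).2 ⟨m, ha, h.right⟩, hb⟩
  have he : Even (dots (a ++ v ++ b)) := by
    have := D.even
    rw [hD] at this
    simpa only [dots_append, Nat.even_add, h.even_dots] using this
  exact (h.link_eq D ⟨_, hc, he⟩ a b ha hb hD rfl).trans
    (h'.link_eq ⟨_, hc, he⟩ E a b ha hb rfl hE)

theorem of_localMove (h : LocalMove u v) (hu : IsTangle u m n) (hv : IsTangle v m n)
    (hd : Even (dots u) ↔ Even (dots v)) : Isotopic m n u v :=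
  ⟨hu, hv, hd, fun _ _ a b _ _ hD hE => Quot.sound ⟨a, b, u, v, h, hD, hE⟩⟩

theorem context (h : Isotopic m n u v) (ha : IsTangle a k m) (hb : IsTangle b n l) :
    Isotopic k l (a ++ u ++ b) (a ++ v ++ b) := by
  refine ⟨?_, ?_, ?_, fun D E a' b' ha' hb' hD hE => ?_⟩
  · exact (isTangle_append _ _ _ _).2 ⟨n, (isTangle_append _ _ _ _).2 ⟨m, ha, h.left⟩, hb⟩
  · exact (isTangle_append _ _ _ _).2 ⟨n, (isTangle_append _ _ _ _).2 ⟨m, ha, h.right⟩, hb⟩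
  · simp only [dots_append, Nat.even_add, h.even_dots]
  · exact h.link_eq D E (a' ++ a) (b ++ b') ((isTangle_append _ _ _ _).2 ⟨k, ha', ha⟩)
      ((isTangle_append _ _ _ _).2 ⟨l, hb, hb'⟩) (by simp [hD]) (by simp [hE])

/-- A local move between diagrams without dots, in context. -/
theorem of_localMove_context (a b : Word) (h : LocalMove u v) (ha : IsTangle a k m)
    (hu : IsTangle u m n) (hv : IsTangle v m n) (hb : IsTangle b n l)
    (hdu : dots u = 0) (hdv : dots v = 0) : Isotopic k l (a ++ u ++ b) (a ++ v ++ b) :=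
  (of_localMove h hu hv (by rw [hdu, hdv])).context ha hb

end Isotopic

/-! ### Isotopies of a twist around two parallel arcs -/

section Twist

variable (ε : Bool) {i m : ℕ} (hi : i + 2 ≤ m)
include hi

theorem isotopic_zero_top :
    Isotopic m m ((RationalTangle.twist ε .top .zero).word i) (RationalTangle.zero.word i) := by
  refine Isotopic.of_localMove_context (m := m - 2) (n := m) [cap i] []
    (.reidemeister_one_cup ε i) ?_ ?_ ?_ ?_ rfl rfl <;>
    simp only [IsTangle, Piece.ins, Piece.outs] <;> omega

theorem isotopic_zero_bottom :
    Isotopic m m ((RationalTangle.twist ε .bottom .zero).word i)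
      (RationalTangle.zero.word i) := by
  refine Isotopic.of_localMove_context (m := m) (n := m - 2) [] [cup i]
    (.reidemeister_one_cap ε i) ?_ ?_ ?_ ?_ rfl rfl <;>
    simp only [IsTangle, Piece.ins, Piece.outs] <;> omega

/-- The crossing is a kink, but its extremum is shared with a zigzag. Sliding the crossing across
the minimum puts it directly under the maximum, where the first Reidemeister move applies. -/
theorem isotopic_infty_right :
    Isotopic m m ((RationalTangle.twist ε .right .infty).word i)
      (RationalTangle.infty.word i) := by
  have h₁ : Isotopic m m [cup (i + 2), cross (!ε) (i + 1), cap (i + 1)]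
      [cup (i + 1), cross ε (i + 2), cap (i + 1)] := by
    have h := LocalMove.slide_cup (!ε) (i + 1)
    rw [Bool.not_not] at h
    refine Isotopic.of_localMove_context (m := m) (n := m + 2) [] [cap (i + 1)]
      h ?_ ?_ ?_ ?_ rfl rfl <;>
      simp only [IsTangle, Piece.ins, Piece.outs] <;> omega
  have h₂ : Isotopic m m [cup (i + 2), cross (!ε) (i + 1), cap (i + 1)]
      [cup (i + 2), cap (i + 1)] := by
    refine Isotopic.of_localMove_context (m := m + 2) (n := m) [cup (i + 2)] []
      (.reidemeister_one_cap (!ε) (i + 1)) ?_ ?_ ?_ ?_ rfl rfl <;>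
      simp only [IsTangle, Piece.ins, Piece.outs] <;> omega
  have h₃ : Isotopic m m [cup (i + 2), cap (i + 1)] [] := by
    refine Isotopic.of_localMove_context (m := m) (n := m) [] []
      (.zigzag_right (i + 1)) ?_ ?_ ?_ ?_ rfl rfl <;>
      simp only [IsTangle, Piece.ins, Piece.outs] <;> omega
  exact h₁.symm.trans (h₂.trans h₃)

theorem isotopic_infty_left :
    Isotopic m m ((RationalTangle.twist ε .left .infty).word i)
      (RationalTangle.infty.word i) := by
  have h₁ : Isotopic m m [cup (i + 1), cross ε i, cap (i + 1)]
      [cup i, cross (!ε) (i + 1), cap (i + 1)] := by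
    refine Isotopic.of_localMove_context (m := m) (n := m + 2) [] [cap (i + 1)]
      (.slide_cup ε i) ?_ ?_ ?_ ?_ rfl rfl <;>
      simp only [IsTangle, Piece.ins, Piece.outs] <;> omega
  have h₂ : Isotopic m m [cup i, cross (!ε) (i + 1), cap (i + 1)] [cup i, cap (i + 1)] := by
    refine Isotopic.of_localMove_context (m := m + 2) (n := m) [cup i] []
      (.reidemeister_one_cap (!ε) (i + 1)) ?_ ?_ ?_ ?_ rfl rfl <;>
      simp only [IsTangle, Piece.ins, Piece.outs] <;> omega
  have h₃ : Isotopic m m [cup i, cap (i + 1)] [] := by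
    refine Isotopic.of_localMove_context (m := m) (n := m) [] []
      (.zigzag_left i) ?_ ?_ ?_ ?_ rfl rfl <;>
      simp only [IsTangle, Piece.ins, Piece.outs] <;> omega
  exact h₁.trans (h₂.trans h₃)

/-- The horizontal arcs merely bend the strands of the added crossing; straightening them is a
planar isotopy. -/
theorem isotopic_zero_right :
    Isotopic m m ((RationalTangle.twist ε .right .zero).word i)
      ((RationalTangle.crossing ε).word i) := by
  have h₁ : Isotopic m m [cup (i + 1), cap i, cup i, cross ε (i + 2), cap (i + 1)]
      [cup i, cross ε (i + 2), cap (i + 1)] := by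
    refine Isotopic.of_localMove_context (m := m) (n := m) [] [cup i, cross ε (i + 2), cap (i + 1)]
      (.zigzag_right i) ?_ ?_ ?_ ?_ rfl rfl <;>
      simp only [IsTangle, Piece.ins, Piece.outs] <;> omega
  have h₂ : Isotopic m m [cup i, cross ε (i + 2), cap (i + 1)]
      [cross ε i, cup i, cap (i + 1)] := by
    refine Isotopic.of_localMove_context (m := m) (n := m + 2) [] [cap (i + 1)]
      (.exchange .cup (.cross ε) i 0) ?_ ?_ ?_ ?_ rfl rfl <;>
      simp only [IsTangle, Piece.ins, Piece.outs] <;> omega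
  have h₃ : Isotopic m m [cross ε i, cup i, cap (i + 1)] [cross ε i] := by
    refine Isotopic.of_localMove_context (m := m) (n := m) [cross ε i] []
      (.zigzag_left i) ?_ ?_ ?_ ?_ rfl rfl <;>
      simp only [IsTangle, Piece.ins, Piece.outs] <;> omega
  exact h₁.trans (h₂.trans h₃)

theorem isotopic_zero_left :
    Isotopic m m ((RationalTangle.twist ε .left .zero).word i)
      ((RationalTangle.crossing ε).word i) := by
  have h₁ : Isotopic m m [cup (i + 1), cross ε i, cap (i + 2), cup (i + 2), cap (i + 1)]
      [cup (i + 1), cross ε i, cap (i + 2)] := by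
    refine Isotopic.of_localMove_context (m := m) (n := m)
      [cup (i + 1), cross ε i, cap (i + 2)] []
      (.zigzag_right (i + 1)) ?_ ?_ ?_ ?_ rfl rfl <;>
      simp only [IsTangle, Piece.ins, Piece.outs] <;> omega
  have h₂ : Isotopic m m [cup (i + 1), cross ε i, cap (i + 2)]
      [cup (i + 1), cap (i + 2), cross ε i] := by
    refine Isotopic.of_localMove_context (m := m + 2) (n := m) [cup (i + 1)] []
      (.exchange (.cross ε) .cap i 0) ?_ ?_ ?_ ?_ rfl rfl <;>
      simp only [IsTangle, Piece.ins, Piece.outs] <;> omega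
  have h₃ : Isotopic m m [cup (i + 1), cap (i + 2), cross ε i] [cross ε i] := by
    refine Isotopic.of_localMove_context (m := m) (n := m) [] [cross ε i]
      (.zigzag_left (i + 1)) ?_ ?_ ?_ ?_ rfl rfl <;>
      simp only [IsTangle, Piece.ins, Piece.outs] <;> omega
  exact h₁.trans (h₂.trans h₃)

end Twist

theorem MarkedDiagram.Crossing.link_replace_eq {D : MarkedDiagram} (c : D.Crossing)
    {T T' : RationalTangle}
    (h : ∀ m, c.pos + 2 ≤ m → Isotopic m m (T.word c.pos) (T'.word c.pos)) :
    (D.replace c T).link = (D.replace c T').link := by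
  obtain ⟨m, hm, ha, hb⟩ := c.exists_isTangle
  exact (h m hm).link_eq _ _ c.below c.above ha hb rfl rfl

/-! ### The determinants -/

/-- In the state sum at `A`, the tangle `T` is `α` times the vertical arcs plus `β` times the
horizontal arcs. -/
def RationalTangle.HasCoeffs {K : Type*} [Field K] (A : K) (T : RationalTangle) (α β : K) : Prop :=
  ∀ (i : ℕ) (b : Word) (s : LoopState), s.WellFormed → i + 2 ≤ s.labels.length →
    IsTangle b s.labels.length 0 →
      bracketFrom A (T.word i ++ b) s =
        α * bracketFrom A b s + β * bracketFrom A b ((s.cap i).cup i)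

namespace RationalTangle.HasCoeffs

variable {K : Type*} [Field K] (A : K) (ε : Bool)

theorem crossing : (RationalTangle.crossing ε).HasCoeffs A (inftyCoeff A ε) (zeroCoeff A ε) :=
  fun i b s _ _ _ => bracketFrom_cross A ε i b s

variable {A}

section

variable (hA' : A ^ 2 + A⁻¹ ^ 2 = 0)
include hA'

/-- One smoothing of the kink splits off a circle and vanishes; the other removes the kink. -/
theorem top_zero : (RationalTangle.twist ε .top .zero).HasCoeffs A 0 (inftyCoeff A ε) := by
  intro i b s hs hi hb
  simp only [word, List.cons_append, List.nil_append, bracketFrom_cup, bracketFrom_cap,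
    bracketFrom_cross]
  rw [bracketFrom_cap_cup_cap_cup hA' hs hb hi]
  ring

theorem bottom_zero : (RationalTangle.twist ε .bottom .zero).HasCoeffs A 0 (inftyCoeff A ε) := by
  intro i b s hs hi hb
  simp only [word, List.cons_append, List.nil_append, bracketFrom_cup, bracketFrom_cap,
    bracketFrom_cross]
  rw [bracketFrom_cap_cup_cap_cup hA' hs hb hi]
  ring

/-- Now the vertical smoothing of the kink splits off the circle, and the horizontal one is a pair
of zigzags. -/
theorem right_infty : (RationalTangle.twist ε .right .infty).HasCoeffs A (zeroCoeff A ε) 0 := by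
  intro i b s hs hi hb
  have hs₁ := hs.cup (i := i + 1) (by omega)
  have hl₁ := s.length_cup (i := i + 1) (by omega)
  have hs₂ := hs₁.cap (i := i + 2) (by omega)
  have hl₂ := (s.cup (i + 1)).length_cap (i := i + 2) (by omega)
  have hl : s.labels.length + 2 - 2 = s.labels.length := by omega
  simp only [word, List.cons_append, List.nil_append, List.append_nil, bracketFrom_cup,
    bracketFrom_cap, bracketFrom_cross]
  rw [bracketFrom_cup_cap_self hA' hs hb (by omega) (by rw [← List.length_pos_iff]; omega),
    bracketFrom_cup_cap_right A hs₂ (by rwa [hl₂, hl₁, hl]) (by omega),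
    bracketFrom_cup_cap_left A hs hb (by omega)]
  ring

theorem left_infty : (RationalTangle.twist ε .left .infty).HasCoeffs A (zeroCoeff A ε) 0 := by
  intro i b s hs hi hb
  have hs₁ := hs.cup (i := i + 1) (by omega)
  have hl₁ := s.length_cup (i := i + 1) (by omega)
  have hs₂ := hs₁.cap (i := i) (by omega)
  have hl₂ := (s.cup (i + 1)).length_cap (i := i) (by omega)
  have hl : s.labels.length + 2 - 2 = s.labels.length := by omega
  simp only [word, List.cons_append, List.nil_append, List.append_nil, bracketFrom_cup,
    bracketFrom_cap, bracketFrom_cross]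
  rw [bracketFrom_cup_cap_self hA' hs hb (by omega) (by rw [← List.length_pos_iff]; omega),
    bracketFrom_cup_cap_left A hs₂ (by rwa [hl₂, hl₁, hl]) (by omega),
    bracketFrom_cup_cap_right A hs hb (by omega)]
  ring

end

variable (A)

/-- Only planar isotopy is involved, so no condition on `A` is needed. -/
theorem right_zero :
    (RationalTangle.twist ε .right .zero).HasCoeffs A (inftyCoeff A ε) (zeroCoeff A ε) := by
  intro i b s hs hi hb
  have key : bracketFrom A (cup i :: cross ε (i + 2) :: cap (i + 1) :: b) s =
      bracketFrom A (cross ε i :: b) s := by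
    have hl := s.length_cap_cup hi
    simp only [bracketFrom_cup, bracketFrom_cap, bracketFrom_cross]
    rw [LoopState.cup_cap_eq_cap_cup hs hi,
      bracketFrom_cup_cap_left A hs hb (by omega),
      bracketFrom_cup_cap_right A (hs.cap_cup hi) (by rwa [hl]) (by omega)]
  have hw : IsTangle (cup i :: cross ε (i + 2) :: cap (i + 1) :: b) s.labels.length 0 := by
    simp only [IsTangle, Piece.ins, Piece.outs]
    exact ⟨by omega, by omega, by omega, by simpa using hb⟩
  simp only [word, List.cons_append, List.nil_append]
  rw [bracketFrom_cup, bracketFrom_cap, bracketFrom_cup_cap_right A hs hw (by omega), key,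
    bracketFrom_cross]

theorem left_zero :
    (RationalTangle.twist ε .left .zero).HasCoeffs A (inftyCoeff A ε) (zeroCoeff A ε) := by
  intro i b s hs hi hb
  have hs₁ := hs.cup (i := i + 1) (by omega)
  have hl₁ := s.length_cup (i := i + 1) (by omega)
  have hl : s.labels.length + 2 - 2 = s.labels.length := by omega
  have hs₂ := hs₁.cap (i := i + 2) (by omega)
  have hl₂ := (s.cup (i + 1)).length_cap (i := i + 2) (by omega)
  have hs₃ := hs₁.cap (i := i) (by omega)
  have hl₃ := (s.cup (i + 1)).length_cap (i := i) (by omega)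
  rw [hl₁, hl] at hl₂ hl₃
  have hl₄ := LoopState.length_cap_cup _ (hl₃.symm ▸ hi)
  have hw : IsTangle (cap i :: cup i :: b) s.labels.length 0 := by
    simp only [IsTangle, Piece.ins, Piece.outs]
    exact ⟨by omega, by omega, by rwa [add_zero, Nat.sub_zero, Nat.sub_add_cancel (by omega)]⟩
  have key := bracketFrom_cup_cap_right A (i := i) hs hw (by omega)
  simp only [bracketFrom_cup, bracketFrom_cap] at key
  simp only [word, List.cons_append, List.nil_append, bracketFrom_cup, bracketFrom_cap,
    bracketFrom_cross]
  rw [bracketFrom_cup_cap_right A hs₂ (by rwa [hl₂]) (by omega),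
    bracketFrom_cup_cap_left A hs hb (by omega),
    LoopState.cup_cap_eq_cap_cup hs₃ (by omega),
    bracketFrom_cup_cap_right A (hs₃.cap_cup (by omega)) (by rwa [hl₄, hl₃]) (by omega), key]

end RationalTangle.HasCoeffs

theorem LoopState.wellFormed_empty : (⟨[], 0, 0⟩ : LoopState).WellFormed :=
  ⟨by simp, by simp⟩

theorem MarkedDiagram.Crossing.bracket_replace {K : Type*} [Field K] {A : K} {D : MarkedDiagram}
    (c : D.Crossing) {T : RationalTangle} {α β : K} (h : T.HasCoeffs A α β) :
    (D.replace c T).bracket A =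
      α * (D.replace c .infty).bracket A + β * (D.replace c .zero).bracket A := by
  obtain ⟨m, hm, ha, hb⟩ := c.exists_isTangle
  have := bracketFrom_append_eq A α β c.below (T.word c.pos ++ c.above) c.above
    (cap c.pos :: cup c.pos :: c.above) m
    (fun s hs hl => by
      subst hl
      rw [h c.pos c.above s hs hm hb, bracketFrom_cap, bracketFrom_cup])
    LoopState.wellFormed_empty ha
  simpa [bracket, replace, RationalTangle.word] using this

theorem MarkedDiagram.Crossing.bracket_eq {K : Type*} [Field K] (A : K) {D : MarkedDiagram}
    (c : D.Crossing) : D.bracket A = inftyCoeff A c.sign * (D.replace c .infty).bracket A +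
      zeroCoeff A c.sign * (D.replace c .zero).bracket A := by
  conv_lhs => rw [← c.replace_crossing]
  exact c.bracket_replace (.crossing A c.sign)

/-! ### Equality in the triangle inequality -/

section Norm

variable {E : Type*} [NormedField E] [NormedSpace ℝ E] [StrictConvexSpace ℝ E]

/-- By strict convexity, equality puts `x` and `y` on the same ray, and then `x + y` lies on the ray
of `y`. -/
theorem norm_add_add_of_norm_add {x y : E} (h : ‖x + y‖ = ‖x‖ + ‖y‖) :
    ‖x + y + y‖ = ‖x + y‖ + ‖y‖ :=
  ((sameRay_iff_norm_add.2 h).add_left (.refl y)).norm_add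

/-- Additivity of the determinant for a crossing added on the top or the bottom. -/
theorem norm_vertical {p q X Y : E} (hp : ‖p‖ = 1) (hq : ‖q‖ = 1)
    (h : ‖p * X + q * Y‖ = ‖X‖ + ‖Y‖) :
    ‖p * (p * X + q * Y) + q * (p * Y)‖ = ‖p * X + q * Y‖ + ‖p * Y‖ := by
  have h' : ‖p * X + q * Y‖ = ‖p * X‖ + ‖q * Y‖ := by simpa [hp, hq] using h
  have := norm_add_add_of_norm_add h'
  -- Up to the unit `p`, the sum is `x + y + y` with `x = p * X` and `y = q * Y`.
  rw [show p * (p * X + q * Y) + q * (p * Y) = p * (p * X + q * Y + q * Y) by ring, norm_mul, hp,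
    one_mul, this, norm_mul, norm_mul, hp, hq]

/-- Additivity of the determinant for a crossing added on the right or the left. -/
theorem norm_horizontal {p q X Y : E} (hp : ‖p‖ = 1) (hq : ‖q‖ = 1)
    (h : ‖p * X + q * Y‖ = ‖X‖ + ‖Y‖) :
    ‖p * (q * X) + q * (p * X + q * Y)‖ = ‖q * X‖ + ‖p * X + q * Y‖ := by
  -- A quarter turn exchanges the roles of `(p, X)` and `(q, Y)`.
  have := norm_vertical hq hp (X := Y) (Y := X) (by rw [add_comm, h, add_comm])
  rw [add_comm, add_comm (p * X), this, add_comm]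

end Norm

/-- The square of this `A` is `i`, so a circle has value 0 at this point. -/
theorem sq_add_inv_sq_exp :
    Complex.exp (Real.pi / 4 * Complex.I) ^ 2 + (Complex.exp (Real.pi / 4 * Complex.I))⁻¹ ^ 2 =
      0 := by
  rw [← Complex.exp_neg, ← Complex.exp_nat_mul, ← Complex.exp_nat_mul]
  have h : ((2 : ℕ) : ℂ) * (Real.pi / 4 * Complex.I) = Real.pi / 2 * Complex.I := by
    push_cast
    ring
  rw [mul_neg, h, ← neg_mul, Complex.exp_mul_I, Complex.exp_mul_I]
  simp

theorem norm_exp_pi_div_four : ‖Complex.exp (Real.pi / 4 * Complex.I)‖ = 1 := by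
  simpa using Complex.norm_exp_ofReal_mul_I (Real.pi / 4)

theorem norm_inftyCoeff {A : ℂ} (hA : ‖A‖ = 1) (ε : Bool) : ‖inftyCoeff A ε‖ = 1 := by
  cases ε <;> simp [inftyCoeff, hA]

theorem norm_zeroCoeff {A : ℂ} (hA : ‖A‖ = 1) (ε : Bool) : ‖zeroCoeff A ε‖ = 1 := by
  cases ε <;> simp [zeroCoeff, hA]

/-! ### Extending a TQA crossing -/

/-- Adding a crossing of the same sign to a TQA crossing keeps it a TQA crossing. -/
theorem MarkedDiagram.Crossing.IsTQA.inner {D : MarkedDiagram} {c : D.Crossing} (hc : c.IsTQA)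
    (σ : Side) : (c.inner c.sign σ).IsTQA := by
  have hD := hc.tqa
  obtain ⟨h₁, h₀, hdet⟩ := c.isTQA_iff.1 hc
  have hp := norm_inftyCoeff norm_exp_pi_div_four c.sign
  have hq := norm_zeroCoeff norm_exp_pi_div_four c.sign
  have hA := sq_add_inv_sq_exp
  have hinner : (c.inner c.sign σ).sign = c.sign := rfl
  rw [isTQA_iff, replace_inner, replace_inner]
  simp only [MarkedDiagram.det] at hdet ⊢
  rw [(c.inner c.sign σ).bracket_eq, replace_inner, replace_inner, hinner]
  rw [c.bracket_eq] at hdet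
  cases σ with
  | right =>
    rw [c.bracket_replace (.right_infty c.sign hA), c.bracket_replace (.right_zero _ c.sign),
      c.link_replace_eq fun m hm => isotopic_infty_right c.sign hm,
      c.link_replace_eq fun m hm => isotopic_zero_right c.sign hm, replace_crossing,
      zero_mul, add_zero]
    exact ⟨h₁, hD, norm_horizontal hp hq hdet⟩
  | left =>
    rw [c.bracket_replace (.left_infty c.sign hA), c.bracket_replace (.left_zero _ c.sign),
      c.link_replace_eq fun m hm => isotopic_infty_left c.sign hm,
      c.link_replace_eq fun m hm => isotopic_zero_left c.sign hm, replace_crossing,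
      zero_mul, add_zero]
    exact ⟨h₁, hD, norm_horizontal hp hq hdet⟩
  | top =>
    -- The vertical arcs have the empty word, so the added crossing takes exactly the place of `c`;
    -- no isotopy is needed.
    have h : D.replace c (.twist c.sign .top .infty) = D := eq_of_word_eq c.word_eq.symm
    rw [c.bracket_replace (.top_zero c.sign hA), h,
      c.link_replace_eq fun m hm => isotopic_zero_top c.sign hm, zero_mul, zero_add, c.bracket_eq]
    exact ⟨hD, h₀, norm_vertical hp hq hdet⟩
  | bottom =>
    have h : D.replace c (.twist c.sign .bottom .infty) = D := eq_of_word_eq c.word_eq.symm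
    rw [c.bracket_replace (.bottom_zero c.sign hA), h,
      c.link_replace_eq fun m hm => isotopic_zero_bottom c.sign hm, zero_mul, zero_add,
      c.bracket_eq]
    exact ⟨hD, h₀, norm_vertical hp hq hdet⟩

end DottedLink

theorem proposition6p3 (D : DottedLink.MarkedDiagram) (c : D.Crossing) (hc : c.IsTQA)
    (T : DottedLink.RationalTangle) (hT : T.Extends c.sign) :
    DottedLink.TQA (D.replace c T).link := by
  induction T generalizing D with
  | zero => exact hT.elim
  | infty => exact hT.elim
  | crossing ε =>
    have hε : ε = c.sign := hT
    rw [hε, c.replace_crossing]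
    exact hc.tqa
  | twist ε σ T ih =>
    obtain ⟨rfl, hT⟩ := hT
    -- The outermost crossing is added around `c` first; `T` then extends the core crossing of this
    -- new diagram, which is again TQA. Hence the induction over all `D`.
    rw [← c.replace_inner]
    exact ih _ (c.inner c.sign σ) (hc.inner σ) hT
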